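/- Let $d\ge 3$. Write $\|\cdot\|$ for the Euclidean norm, and for a finite set $A\subset\mathbb Z^d$ let $\partial A$ be the set of points of $\mathbb Z^d\setminus A$ at distance $1$ from some point of $A$, let $\operatorname{rad}(A)=\max_{x\in A}\|x\|$, let $C_z=z+[-\tfrac12,\tfrac12]^d$ for $z\in\mathbb Z^d$, and let $\square A=\bigcup_{z\in A}C_z$. Let $A(d,1)$ be the space of lines in $\mathbb R^d$ with the $\sigma$-algebra generated by the sets $[K]=\{L: L\cap K\neq\emptyset\}$, $K$ a convex body, and let $\mu_1$ be the motion-invariant measure on $A(d,1)$ that gives the lines hitting the unit ball the mass $\kappa_{d-1}$ (the volume of the $(d-1)$-dimensional unit ball); explicitly, $\mu_1(B)=\int_{\mathbb S^{d-1}}\lambda_{v^\perp}(\{x\in v^\perp: x+\mathbb Rv\in B\})\,\sigma(dv)$, where $\sigma$ is the uniform distribution on the sphere and $\lambda_{v^\perp}$ is Lebesgue measure on $v^\perp$. For nonempty finite $A\subset\mathbb Z^d$ let $\mathbb P^{\square A}=\mu_1(\,\cdot\cap[\square A])/\mu_1([\square A])$, the law of an isotropic random line through $\square A$. For a line $L$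 let $L^A=\{z\in A: C_z\cap L\ne\emptyset\}$, and order $L^A$ by the time at which the cubes are entered when $L$ is traversed in a fixed direction $v_L$ (the unit vector parallel to $L$ whose first nonzero coordinate is positive), with ties broken lexicographically. The ballistic measure $b_A$ on $A$ is $$b_A(z)=\int_{A(d,1)} b_A(z,L)\,\mathbb P^{\square A}(dL),$$ where $b_A(z,L)=1$ if $L^A=\{z\}$, $b_A(z,L)=\tfrac12$ if $L^A$ has more than one element and $z$ is its first or its last element, and $b_A(z,L)=0$ otherwise. Ballistic aggregation in $\mathbb Z^d$ is a sequence $(F_n)_{n\ge1}$ of random finite subsets of $\mathbb Z^d$ on a probability space such that $F_1=\{0\}$ and, for every $n\ge1$, $F_{n+1}=F_n\cup\{y_{n+1}\}$ with a random point $y_{n+1}$ whose conditional distribution given $F_n$ is $b_{\partial F_n}$, that is, $\mathbb P(y_{n+1}=z\mid F_n=A)=b_{\partial A}(z)$ for all $z\in\mathbb Z^d$ and all finite $A$ with $\mathbb P(F_n=A)>0$. Let $(F_n)_{n\ge1}$ be ballistic aggregation in $\mathbb Z^d$. Then its lower fractal dimension satisfies, almost surely, $$\underline{\delta}_f=\liminf_{n\to\infty}\frac{\log(\#F_n)}{\log(\operatorname{rad}(F_n))}\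 \ge\ 2 .$$ (Almost surely $\#F_n=n$ for all $n$, so the numerator is $\log n$.) -/

import Mathlib

open MeasureTheory ProbabilityTheory Filter
open scoped ENNReal NNReal Topology

noncomputable section

namespace BallisticAggregation

/-! ### Finite subsets of the lattice -/

/-- The lattice `ℤ^d`. -/
abbrev Lattice (d : ℕ) : Type := Fin d → ℤ

/-- The Euclidean space `ℝ^d`. -/
abbrev Space (d : ℕ) : Type := EuclideanSpace ℝ (Fin d)

/-- The natural embedding of `ℤ^d` into `ℝ^d`. -/
def toSpace {d : ℕ} (z : Lattice d) : Space d := WithLp.toLp 2 fun i => (z i : ℝ)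

/-- The edges of the nearest neighbour graph: Euclidean distance one. -/
def IsNeighbor {d : ℕ} (x y : Lattice d) : Prop := ‖toSpace x - toSpace y‖ = 1

/-- The set of lattice points outside `A` that have a nearest neighbour in `A`. -/
def boundarySet {d : ℕ} (A : Finset (Lattice d)) : Set (Lattice d) :=
  {y | y ∉ A ∧ ∃ x ∈ A, IsNeighbor x y}

theorem boundarySet_finite {d : ℕ} (A : Finset (Lattice d)) : (boundarySet A).Finite := by
  refine (A.finite_toSet.biUnion fun x _ => Set.finite_Icc (x - 1) (x + 1)).subset ?_
  rintro y ⟨-, x, hx, hxy⟩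
  have key : ∀ i, |x i - y i| ≤ 1 := fun i => by
    have h := PiLp.norm_apply_le (toSpace x - toSpace y) i
    rw [hxy] at h
    have h' : |((x i : ℝ) - (y i : ℝ))| ≤ 1 := by simpa [toSpace] using h
    exact_mod_cast h'
  refine Set.mem_biUnion (show x ∈ (A : Set (Lattice d)) from hx) ⟨fun i => ?_, fun i => ?_⟩ <;>
  · have := abs_le.1 (key i)
    simp only [Pi.sub_apply, Pi.add_apply, Pi.one_apply]
    omega

/-- The outer boundary `∂A` of a finite set `A`. -/
def outerBoundary {d : ℕ} (A : Finset (Lattice d)) : Finset (Lattice d) :=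
  (boundarySet_finite A).toFinset

/-- The radius `max_{x ∈ A} ‖x‖` (Euclidean norm) of a finite set `A`. -/
def rad {d : ℕ} (A : Finset (Lattice d)) : ℝ :=
  ((A.sup fun x => ‖toSpace x‖₊ : ℝ≥0) : ℝ)

/-- The lower fractal dimension `liminf log (# A_n) / log (rad A_n)` of a sequence of finite sets,
as an extended real number. -/
def lowerFractalDim {d : ℕ} (A : ℕ → Finset (Lattice d)) : EReal :=
  liminf (fun n => ((Real.log (A n).card / Real.log (rad (A n)) : ℝ) : EReal)) atTop

/-! ### Incremental aggregation -/

/-- A sequence `F 1, F 2, …` of random finite subsets of `ℤ^d` is incremental aggregation with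
distribution family `μ`, where `μ A z` is the mass that the distribution on `A` gives to `z`:
`F 1 = {0}`, and `F (n + 1) = F n ∪ {y (n + 1)}`, where the conditional distribution of the random
point `y (n + 1)` given `F n` is the distribution on the outer boundary of `F n`.
The family of finite sets carries the discrete sigma-algebra. The value `F 0` plays no role. -/
structure IsIncrementalAggregation {d : ℕ} (μ : Finset (Lattice d) → Lattice d → ℝ≥0∞)
    {Ω : Type*} [MeasurableSpace Ω] (P : Measure Ω) (F : ℕ → Ω → Finset (Lattice d)) : Prop where
  measurable : ∀ n, 1 ≤ n → Measurable[_, ⊤] (F n)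
  init : ∀ ω, F 1 ω = {0}
  step : ∃ y : ℕ → Ω → Lattice d, ∀ n, 1 ≤ n →
    Measurable (y (n + 1)) ∧
    (∀ ω, F (n + 1) ω = F n ω ∪ {y (n + 1) ω}) ∧
    ∀ A : Finset (Lattice d), P {ω | F n ω = A} ≠ 0 →
      ∀ z, P[|{ω | F n ω = A}] {ω | y (n + 1) ω = z} = μ (outerBoundary A) z

/-! ### The space of lines and its motion invariant measure -/

/-- The space `A(d,1)` of lines in `ℝ^d`. -/
def Line (d : ℕ) : Type :=
  {L : AffineSubspace ℝ (Space d) // Module.finrank ℝ L.direction = 1}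

/-- The set of points of a line. -/
def Line.points {d : ℕ} (L : Line d) : Set (Space d) := (L.1 : Set (Space d))

/-- The set `[K]` of lines hitting `K`. -/
def hitting {d : ℕ} (K : Set (Space d)) : Set (Line d) := {L | (L.points ∩ K).Nonempty}

/-- The sigma-algebra on the space of lines, generated by the sets `[K]`, `K` a convex body. -/
instance (d : ℕ) : MeasurableSpace (Line d) :=
  MeasurableSpace.generateFrom
    {B | ∃ K : Set (Space d), IsCompact K ∧ Convex ℝ K ∧ B = hitting K}

/-- The unit sphere of `ℝ^d`. -/
abbrev Sphere (d : ℕ) : Type := Metric.sphere (0 : Space d) 1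

/-- The line through `x` with direction `v`. -/
def lineThrough {d : ℕ} (v : Sphere d) (x : Space d) : Line d :=
  ⟨AffineSubspace.mk' x (ℝ ∙ (v : Space d)), by
    rw [AffineSubspace.direction_mk']
    exact finrank_span_singleton (ne_zero_of_mem_unit_sphere v)⟩

/-- The uniform distribution on the unit sphere. -/
def sphereUniform (d : ℕ) : Measure (Sphere d) :=
  ((volume : Measure (Space d)).toSphere Set.univ)⁻¹ • (volume : Measure (Space d)).toSphere

/-- The orthogonal complement of the direction `v`. -/
abbrev perp {d : ℕ} (v : Sphere d) : Submodule ℝ (Space d) := (ℝ ∙ (v : Space d))ᗮ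

/-- The `(d-1)`-dimensional Lebesgue measure, in the hyperplane orthogonal to `v`, of the set of
those `x` for which the line through `x` with direction `v` belongs to `B`. -/
def perpVolume {d : ℕ} (B : Set (Line d)) (v : Sphere d) : ℝ≥0∞ :=
  (volume : Measure (perp v)) {x | lineThrough v (x : Space d) ∈ B}

theorem mem_points_lineThrough {d : ℕ} (v : Sphere d) (x p : Space d) :
    p ∈ (lineThrough v x).points ↔ p - x = inner ℝ (v : Space d) (p - x) • (v : Space d) := by
  have hv : ‖(v : Space d)‖ = 1 := norm_eq_of_mem_sphere v
  change p ∈ AffineSubspace.mk' x (ℝ ∙ (v : Space d)) ↔ _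
  rw [AffineSubspace.mem_mk', vsub_eq_sub, Submodule.mem_span_singleton]
  constructor
  · rintro ⟨t, ht⟩
    rw [← ht, inner_smul_right, real_inner_self_eq_norm_sq, hv]
    simp
  · intro h
    exact ⟨_, h.symm⟩

theorem measurable_lineThrough (d : ℕ) :
    Measurable fun q : Sphere d × Space d => lineThrough q.1 q.2 := by
  refine measurable_generateFrom ?_
  rintro B ⟨K, hK, -, rfl⟩
  have : CompactSpace K := isCompact_iff_compactSpace.1 hK
  let S : Set ((Sphere d × Space d) × K) :=
    {q | (q.2 : Space d) - q.1.2
      = inner ℝ (q.1.1 : Space d) ((q.2 : Space d) - q.1.2) • (q.1.1 : Space d)}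
  have hS : IsClosed S := isClosed_eq (by fun_prop) (by fun_prop)
  have hcl := isClosedMap_fst_of_compactSpace S hS
  convert hcl.measurableSet using 1
  ext q
  constructor
  · rintro ⟨p, hp, hpK⟩
    exact ⟨(q, ⟨p, hpK⟩), (mem_points_lineThrough _ _ _).1 hp, rfl⟩
  · rintro ⟨⟨q', p⟩, h, rfl⟩
    exact ⟨p, (mem_points_lineThrough _ _ _).2 h, p.2⟩

theorem measurable_lineThrough_perp {d : ℕ} (v : Sphere d) :
    Measurable fun x : perp v => lineThrough v (x : Space d) := by
  have hf : Measurable fun x : perp v => (x : Space d) := measurable_subtype_coe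
  have hh : Measurable fun y : Space d => lineThrough v y := by
    have h := (measurable_lineThrough d).comp
      (g := fun q : Sphere d × Space d => lineThrough q.1 q.2)
      (f := fun y : Space d => (v, y)) measurable_prodMk_left
    exact h
  exact hh.comp hf

theorem lineThrough_proj {d : ℕ} (v : Sphere d) (y : Space d) :
    lineThrough v ((perp v).orthogonalProjectionOnto y : Space d) = lineThrough v y := by
  refine Subtype.ext ?_
  have h := (perp v).sub_starProjection_mem_orthogonal y
  rw [Submodule.orthogonal_orthogonal] at h
  have h' : (((perp v).orthogonalProjectionOnto y : Space d)) ∈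
      AffineSubspace.mk' y (ℝ ∙ (v : Space d)) := by
    rw [AffineSubspace.mem_mk', vsub_eq_sub, ← Submodule.neg_mem_iff, neg_sub]
    exact h
  have := AffineSubspace.mk'_eq h'
  rwa [AffineSubspace.direction_mk'] at this

/-- Fubini: the volume in the hyperplane equals the volume in `ℝ^d` of a slab of height one. -/
theorem perpVolume_eq {d : ℕ} {B : Set (Line d)} (hB : MeasurableSet B) (v : Sphere d) :
    perpVolume B v = (volume : Measure (Space d))
      {y | |inner ℝ (v : Space d) y| < 1 / 2 ∧ lineThrough v y ∈ B} := by
  have hv : ‖(v : Space d)‖ = 1 := norm_eq_of_mem_sphere v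
  let K : Submodule ℝ (Space d) := ℝ ∙ (v : Space d)
  have hmp : MeasurePreserving
      (fun y : Space d => (K.orthogonalProjectionOnto y, Kᗮ.orthogonalProjectionOnto y)) := by
    have := (WithLp.volume_preserving_ofLp K Kᗮ).comp K.orthogonalDecomposition.measurePreserving
    have hfun : (@WithLp.ofLp 2 (K × Kᗮ)) ∘ K.orthogonalDecomposition
        = fun y : Space d => (K.orthogonalProjectionOnto y, Kᗮ.orthogonalProjectionOnto y) :=
      funext fun y => congrArg WithLp.ofLp (K.orthogonalDecomposition_apply y)
    exact hfun ▸ this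
  have hm := measurable_lineThrough_perp v
  have hball : (volume : Measure K) (Metric.ball 0 (1 / 2)) = 1 := by
    let e := LinearIsometryEquiv.toSpanUnitSingleton (𝕜 := ℝ) (v : Space d) hv
    have := e.measurePreserving.measure_preimage
      (Metric.isOpen_ball (x := (0 : K)) (ε := 1 / 2)).measurableSet.nullMeasurableSet
    rw [← this, LinearIsometryEquiv.preimage_ball, map_zero, Real.volume_ball]
    norm_num
  have hset : {y : Space d | |inner ℝ (v : Space d) y| < 1 / 2 ∧ lineThrough v y ∈ B}
      = (fun y : Space d => (K.orthogonalProjectionOnto y, Kᗮ.orthogonalProjectionOnto y)) ⁻¹'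
        (Metric.ball 0 (1 / 2) ×ˢ {x : perp v | lineThrough v (x : Space d) ∈ B}) := by
    ext y
    have h1 : ‖K.orthogonalProjectionOnto y‖ = |inner ℝ (v : Space d) y| := by
      change ‖K.starProjection y‖ = _
      rw [Submodule.starProjection_unit_singleton ℝ hv, norm_smul, hv, mul_one, Real.norm_eq_abs]
    have h2 := lineThrough_proj v y
    change _ ↔ K.orthogonalProjectionOnto y ∈ Metric.ball 0 (1 / 2) ∧
      lineThrough v ((perp v).orthogonalProjectionOnto y : Space d) ∈ B
    rw [h2, mem_ball_zero_iff, h1]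
    rfl
  rw [hset]
  refine Eq.symm ((hmp.measure_preimage
    (Metric.isOpen_ball.measurableSet.prod (hm hB)).nullMeasurableSet).trans ?_)
  change ((volume : Measure K).prod (volume : Measure (perp v))) _ = _
  rw [Measure.prod_prod, hball, one_mul]
  rfl

theorem measurable_perpVolume {d : ℕ} {B : Set (Line d)} (hB : MeasurableSet B) :
    Measurable (perpVolume B) := by
  have h : MeasurableSet {q : Sphere d × Space d |
      |inner ℝ (q.1 : Space d) q.2| < 1 / 2 ∧ lineThrough q.1 q.2 ∈ B} := by
    refine MeasurableSet.inter ?_ (measurable_lineThrough d hB)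
    have hc : Continuous fun q : Sphere d × Space d => |inner ℝ (q.1 : Space d) q.2| := by
      fun_prop
    exact (isOpen_lt hc continuous_const).measurableSet
  rw [funext (perpVolume_eq hB)]
  exact measurable_measure_prodMk_left h

theorem perpVolume_empty {d : ℕ} (v : Sphere d) : perpVolume (∅ : Set (Line d)) v = 0 :=
  measure_empty (μ := (volume : Measure (perp v)))

theorem perpVolume_iUnion {d : ℕ} {f : ℕ → Set (Line d)} (hf : ∀ i, MeasurableSet (f i))
    (hd : Pairwise (Function.onFun Disjoint f)) (v : Sphere d) :
    perpVolume (⋃ i, f i) v = ∑' i, perpVolume (f i) v := by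
  have hm := measurable_lineThrough_perp v
  have h : {x : perp v | lineThrough v (x : Space d) ∈ ⋃ i, f i}
      = ⋃ i, (fun x : perp v => lineThrough v (x : Space d)) ⁻¹' f i := by
    rw [← Set.preimage_iUnion]
    rfl
  rw [perpVolume, h]
  exact measure_iUnion (fun i j hij => (hd hij).preimage _) fun i => hm (hf i)

/-- The motion invariant measure `μ₁` on the space of lines with `μ₁ [unit ball] = κ_{d-1}`:
the direction of the line is uniformly distributed, and, given the direction, the point where the
line meets the orthogonal hyperplane is distributed according to Lebesgue measure. -/
def lineMeasure (d : ℕ) : Measure (Line d) :=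
  Measure.ofMeasurable (fun B _ => ∫⁻ v, perpVolume B v ∂(sphereUniform d))
    (by rw [lintegral_congr perpVolume_empty, lintegral_zero])
    (fun f hf hd => by
      rw [← lintegral_tsum fun i => (measurable_perpVolume (hf i)).aemeasurable]
      exact lintegral_congr fun v => perpVolume_iUnion hf hd v)

theorem lineMeasure_apply {d : ℕ} {B : Set (Line d)} (hB : MeasurableSet B) :
    lineMeasure d B = ∫⁻ v, perpVolume B v ∂(sphereUniform d) :=
  Measure.ofMeasurable_apply B hB

/-! ### The ballistic measure -/

/-- The closed unit cube centred at the lattice point `z`. -/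
def cube {d : ℕ} (z : Lattice d) : Set (Space d) := {x | ∀ i, |x i - (z i : ℝ)| ≤ 1 / 2}

/-- The union `□A` of the cubes centred at the points of `A`. -/
def boxUnion {d : ℕ} (A : Finset (Lattice d)) : Set (Space d) := ⋃ z ∈ A, cube z

/-- The distribution of an isotropic random line through `K`. -/
def isotropicLine {d : ℕ} (K : Set (Space d)) : Measure (Line d) := (lineMeasure d)[|hitting K]

theorem Line.exists_direction {d : ℕ} (L : Line d) :
    ∃ v ∈ L.1.direction, ‖v‖ = 1 ∧ (0 : Lex (Fin d → ℝ)) < toLex (WithLp.ofLp v) := by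
  obtain ⟨w, hw, -⟩ := finrank_eq_one_iff'.1 L.2
  have hw' : (w : Space d) ≠ 0 := fun h => hw (Subtype.ext h)
  let u : Space d := ‖(w : Space d)‖⁻¹ • (w : Space d)
  have hu : u ∈ L.1.direction := Submodule.smul_mem _ _ w.2
  have hu1 : ‖u‖ = 1 := norm_smul_inv_norm (𝕜 := ℝ) hw'
  have hu0 : toLex (WithLp.ofLp u) ≠ 0 := fun h => by
    have h0 : WithLp.ofLp u = 0 := h
    have : u = 0 := by
      ext i
      exact congrFun h0 i
    simp [this] at hu1
  rcases lt_or_gt_of_ne hu0 with h | h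
  · refine ⟨-u, Submodule.neg_mem _ hu, by rw [norm_neg, hu1], ?_⟩
    exact neg_pos.2 h
  · exact ⟨u, hu, hu1, h⟩

/-- A direction `v_L` of the line `L`: the unit vector parallel to `L` whose first nonzero
coordinate is positive. -/
def Line.direction {d : ℕ} (L : Line d) : Space d := L.exists_direction.choose

/-- The time at which a particle travelling along `L` in direction `v_L` enters the cube centred
at `z`. (It is only used for lines that hit this cube. The time of a point `x` of `L` is measured
by the inner product of `x` and `v_L`.) -/
def entryTime {d : ℕ} (L : Line d) (z : Lattice d) : ℝ :=
  sInf ((fun x => inner ℝ L.direction x) '' (L.points ∩ cube z))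

/-- The order in which a line visits the cubes that it hits; ties are broken by the
lexicographic order on the lattice. -/
def VisitedBefore {d : ℕ} (L : Line d) (z w : Lattice d) : Prop :=
  entryTime L z < entryTime L w ∨ (entryTime L z = entryTime L w ∧ toLex z ≤ toLex w)

open Classical in
/-- The set `L^A` of the points of `A` whose cubes are hit by `L`. -/
def hitPoints {d : ℕ} (A : Finset (Lattice d)) (L : Line d) : Finset (Lattice d) :=
  A.filter fun z => (L.points ∩ cube z).Nonempty

/-- `z` is the first point `min (L^A)` of `A` visited by `L`. -/
def IsFirstVisited {d : ℕ} (A : Finset (Lattice d)) (L : Line d) (z : Lattice d) : Prop :=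
  z ∈ hitPoints A L ∧ ∀ w ∈ hitPoints A L, VisitedBefore L z w

/-- `z` is the last point `max (L^A)` of `A` visited by `L`. -/
def IsLastVisited {d : ℕ} (A : Finset (Lattice d)) (L : Line d) (z : Lattice d) : Prop :=
  z ∈ hitPoints A L ∧ ∀ w ∈ hitPoints A L, VisitedBefore L w z

open Classical in
/-- The mass that the line `L`, traversed in a random direction, contributes to the point `z`. -/
def ballisticWeight {d : ℕ} (A : Finset (Lattice d)) (z : Lattice d) (L : Line d) : ℝ≥0∞ :=
  if hitPoints A L = {z} then 1
  else if 1 < (hitPoints A L).card ∧ (IsFirstVisited A L z ∨ IsLastVisited A L z) then 1 / 2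
  else 0

/-- The mass `b_A(z)` that the ballistic measure on `A` gives to `z`. -/
def ballisticMeasure {d : ℕ} (A : Finset (Lattice d)) (z : Lattice d) : ℝ≥0∞ :=
  ∫⁻ L, ballisticWeight A z L ∂(isotropicLine (boxUnion A))

/-- Ballistic aggregation on `ℤ^d`: incremental aggregation with the ballistic measures. -/
def IsBallisticAggregation {d : ℕ} {Ω : Type*} [MeasurableSpace Ω] (P : Measure Ω)
    (F : ℕ → Ω → Finset (Lattice d)) : Prop :=
  IsIncrementalAggregation ballisticMeasure P F

end BallisticAggregation

end

noncomputable section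

namespace BallisticAggregation

variable {d : ℕ}

/-! ### Lattice geometry -/


/-! It suffices that almost surely `rad (F n ω)` is eventually at most of order `√n`. Two facts give
this.

The first is geometric (`exists_ballisticMeasure_le`): if `A` is connected, contains the origin and
has radius at least `R`, then the ballistic measure on its outer boundary gives each point mass at
most `C / R`. A point is charged only by lines through its own cube, and these have bounded measure.
On the other hand, lines hitting the cubes of the outer boundary have measure at least of order `R`
(`le_perpVolume_hitting`): for every direction `v` not too close to that of a far point `x` of `A`,
a path in `A` from `0` to `x` meets order `R` well separated levels in a direction `u` orthogonal to
`v`. Moving from there along `v` until `A` is left changes the level only boundedly, so the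
projection of the boundary cubes along `v` contains order `R` disjoint balls.

The second is probabilistic. The sum over the set of the weights `exp (‖z‖ - R)⁺` grows in mean, at
each step, at most by a factor `1 + a / R` and a summand `e` (`tsum_mul_totalWeight_le`). Hence its
mean at time `n` is at most `exp (n a / R) (1 + n e)`, whereas it is at least `exp R` once the
radius is `2 R`. Markov's inequality with `R` a large multiple of `√n` gives summable tail bounds,
and Borel–Cantelli concludes. -/

theorem norm_le_of_abs_apply_le {x : Space d} {c : ℝ} (hc : 0 ≤ c) (h : ∀ i, |x i| ≤ c) :
    ‖x‖ ≤ d * c := by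
  refine le_of_sq_le_sq ?_ (by positivity)
  rw [EuclideanSpace.real_norm_sq_eq]
  have h1 : ∑ i, x i ^ 2 ≤ ∑ _i : Fin d, c ^ 2 :=
    Finset.sum_le_sum fun i _ => sq_le_sq' (abs_le.1 (h i)).1 (abs_le.1 (h i)).2
  have h2 : (d : ℝ) ≤ (d : ℝ) ^ 2 := by exact_mod_cast Nat.le_self_pow two_ne_zero d
  rw [Finset.sum_const, Finset.card_univ, Fintype.card_fin, nsmul_eq_mul] at h1
  nlinarith [sq_nonneg c]

@[simp] theorem toSpace_apply (z : Lattice d) (i : Fin d) : toSpace z i = (z i : ℝ) := rfl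

@[simp] theorem toSpace_zero : toSpace (0 : Lattice d) = 0 := by
  ext i; simp

theorem mem_outerBoundary {A : Finset (Lattice d)} {y : Lattice d} :
    y ∈ outerBoundary A ↔ y ∉ A ∧ ∃ x ∈ A, IsNeighbor x y := by
  simp [outerBoundary, boundarySet]

theorem isNeighbor_update (x : Lattice d) (i : Fin d) {s : ℤ} (hs : |s| = 1) :
    IsNeighbor x (Function.update x i (x i + s)) := by
  have h : toSpace x - toSpace (Function.update x i (x i + s))
      = EuclideanSpace.single i (-(s : ℝ)) := by
    ext j
    by_cases hj : j = i
    · subst hj; simp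
    · simp [hj]
  have hs' : |(s : ℝ)| = 1 := by exact_mod_cast hs
  rw [IsNeighbor, h]
  simp [hs']

theorem IsNeighbor.mem_Icc {x y : Lattice d} (h : IsNeighbor x y) :
    y ∈ Finset.Icc (x - 1) (x + 1) := by
  have key : ∀ i, |x i - y i| ≤ 1 := fun i => by
    have h1 := PiLp.norm_apply_le (toSpace x - toSpace y) i
    rw [h] at h1
    have h' : |((x i : ℝ) - (y i : ℝ))| ≤ 1 := by simpa using h1
    exact_mod_cast h'
  rw [Finset.mem_Icc]
  refine ⟨fun i => ?_, fun i => ?_⟩ <;>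
  · have := abs_le.1 (key i)
    simp only [Pi.sub_apply, Pi.add_apply, Pi.one_apply]
    omega

theorem card_Icc_neighborhood (x : Lattice d) : (Finset.Icc (x - 1) (x + 1)).card = 3 ^ d := by
  rw [Pi.card_Icc]
  have : ∀ i, (Finset.Icc ((x - 1) i) ((x + 1) i)).card = 3 := fun i => by
    simp; ring_nf; rfl
  simp only [this, Finset.prod_const, Finset.card_univ, Fintype.card_fin]

/-- A finite set that contains `a` but not `b` has an outer boundary point in the box with
opposite corners `a` and `b`. -/
theorem exists_mem_outerBoundary_uIcc {A : Finset (Lattice d)} {a b : Lattice d} (ha : a ∈ A)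
    (hb : b ∉ A) : ∃ w ∈ outerBoundary A, ∀ i, w i ∈ Set.uIcc (a i) (b i) := by
  classical
  -- Take the point of `A` in the box that is `ℓ¹`-closest to `b`. A unit step towards `b` stays in
  -- the box and, by minimality, leaves `A`.
  obtain ⟨w, hw, hmin⟩ := (A.filter fun w => ∀ i, w i ∈ Set.uIcc (a i) (b i)).exists_min_image
    (fun w => ∑ i, |b i - w i|) ⟨a, by simp [ha]⟩
  simp only [Finset.mem_filter] at hw hmin
  obtain ⟨i, hi⟩ : ∃ i, w i ≠ b i := by
    by_contra! h
    exact hb (funext h ▸ hw.1)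
  obtain ⟨s, hs, hlt, hmem⟩ : ∃ s : ℤ, |s| = 1 ∧ |b i - (w i + s)| < |b i - w i| ∧
      w i + s ∈ Set.uIcc (a i) (b i) := by
    have hwi := hw.2 i
    rw [Set.mem_uIcc] at hwi
    rcases lt_or_gt_of_ne hi with h | h
    · refine ⟨1, by simp, ?_, ?_⟩
      · rw [abs_of_nonneg (by omega), abs_of_nonneg (by omega)]; omega
      · rw [Set.mem_uIcc]; omega
    · refine ⟨-1, by simp, ?_, ?_⟩
      · rw [abs_of_nonpos (by omega), abs_of_nonpos (by omega)]; omega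
      · rw [Set.mem_uIcc]; omega
  have hbox : ∀ j, Function.update w i (w i + s) j ∈ Set.uIcc (a j) (b j) := fun j => by
    by_cases hj : j = i
    · subst hj; simpa using hmem
    · simpa [hj] using hw.2 j
  refine ⟨Function.update w i (w i + s), mem_outerBoundary.2 ⟨fun hA => ?_, w, hw.1,
    isNeighbor_update w i hs⟩, hbox⟩
  refine (hmin _ ⟨hA, hbox⟩).not_gt (Finset.sum_lt_sum (fun j _ => ?_) ⟨i, Finset.mem_univ i, ?_⟩)
  · by_cases hj : j = i
    · subst hj; simpa using hlt.le
    · simp [hj]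
  · simpa using hlt

/-- From a point of a finite set one reaches the outer boundary along any given direction. -/
theorem exists_mem_outerBoundary_near_ray {A : Finset (Lattice d)} {z : Lattice d} (hz : z ∈ A)
    {v : Space d} (hv : ‖v‖ = 1) :
    ∃ w ∈ outerBoundary A, ∃ t : ℝ, ‖toSpace w - (toSpace z + t • v)‖ ≤ 3 * d := by
  -- Lattice approximations of the points `z + m v`. Since `A` is finite, the sequence leaves `A` at
  -- some step; the boundary point is then sought in the box spanned by the two roundings involved.
  let r : ℕ → Lattice d := fun m i => round (z i + m * v i)
  have hr : ∀ m i, |(r m i : ℝ) - (z i + m * v i)| ≤ 1 / 2 := fun m i => by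
    rw [abs_sub_comm]; exact abs_sub_round _
  have hvi : ∀ i, |v i| ≤ 1 := fun i => hv ▸ PiLp.norm_apply_le v i
  have h0 : r 0 = z := by
    funext i
    simp [r]
  obtain ⟨m, hm, hm'⟩ : ∃ m, r m ∈ A ∧ r (m + 1) ∉ A := by
    by_contra! h
    have hall : ∀ m, r m ∈ A := fun m => by
      induction m with
      | zero => rwa [h0]
      | succ m ih => exact h m ih
    obtain ⟨B, hB⟩ := (A.finite_toSet.image fun x => ‖toSpace x‖).bddAbove
    obtain ⟨m, hm⟩ := exists_nat_gt (B + d * (1 / 2) + ‖toSpace z‖)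
    have h1 : ‖toSpace (r m)‖ ≤ B := hB ⟨r m, hall m, rfl⟩
    have h2 : ‖toSpace (r m) - (toSpace z + (m : ℝ) • v)‖ ≤ d * (1 / 2) :=
      norm_le_of_abs_apply_le (by norm_num) fun i => by simpa using hr m i
    have h3 : ‖(m : ℝ) • v‖ = m := by rw [norm_smul, hv]; simp
    have h4 : (m : ℝ) • v = toSpace (r m) - (toSpace (r m) - (toSpace z + (m : ℝ) • v))
        - toSpace z := by abel
    have h5 := norm_sub_le (toSpace (r m) - (toSpace (r m) - (toSpace z + (m : ℝ) • v)))
      (toSpace z)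
    have h6 := norm_sub_le (toSpace (r m)) (toSpace (r m) - (toSpace z + (m : ℝ) • v))
    rw [← h4, h3] at h5
    linarith
  obtain ⟨w, hw, hbox⟩ := exists_mem_outerBoundary_uIcc hm hm'
  refine ⟨w, hw, m, ?_⟩
  rw [mul_comm]
  refine norm_le_of_abs_apply_le (by norm_num) fun i => ?_
  have h1 := hr m i
  have h2 := hr (m + 1) i
  have h3 : |(w i : ℝ) - r m i| ≤ |(r (m + 1) i : ℝ) - r m i| := by
    exact_mod_cast Set.abs_sub_left_of_mem_uIcc (hbox i)
  have h4 := hvi i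
  -- Displacement at most `1` along `v` plus two rounding errors of `1/2`. With the rounding error
  -- at `m`, each coordinate is off by at most `5/2 ≤ 3`.
  have h5 : |(r (m + 1) i : ℝ) - r m i| ≤ 2 := by
    push_cast at h2
    rw [abs_le] at *
    constructor <;> linarith
  have h6 : |(w i : ℝ) - (z i + m * v i)| ≤ 3 := by
    have := abs_sub_le (w i : ℝ) (r m i) (z i + m * v i)
    linarith
  simpa using h6

/-- A finite set is rooted if each of its points can be reached from the origin by a nearest
neighbour path in the set. -/
def IsRooted (A : Finset (Lattice d)) : Prop :=
  0 ∈ A ∧ ∀ x ∈ A, Relation.ReflTransGen (fun a b => b ∈ A ∧ IsNeighbor a b) 0 x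

theorem isRooted_singleton_zero : IsRooted ({0} : Finset (Lattice d)) := by
  refine ⟨by simp, fun x hx => ?_⟩
  rw [Finset.mem_singleton.1 hx]

theorem IsRooted.union_singleton {A : Finset (Lattice d)} (hA : IsRooted A) {z : Lattice d}
    (hz : z ∈ outerBoundary A) : IsRooted (A ∪ {z}) := by
  obtain ⟨-, x, hx, hxz⟩ := mem_outerBoundary.1 hz
  have hmono : ∀ x ∈ A, Relation.ReflTransGen (fun a b => b ∈ A ∪ {z} ∧ IsNeighbor a b) 0 x :=
    fun x hx => Relation.ReflTransGen.mono
      (fun a b h => ⟨Finset.mem_union_left _ h.1, h.2⟩) 0 x (hA.2 x hx)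
  refine ⟨Finset.mem_union_left _ hA.1, fun y hy => ?_⟩
  rcases Finset.mem_union.1 hy with hy | hy
  · exact hmono y hy
  · rw [Finset.mem_singleton.1 hy]
    exact (hmono x hx).tail ⟨by simp, hxz⟩

/-- A discrete intermediate value argument: along a nearest neighbour path from the origin the
component along `u` changes by at most one per step, so it cannot jump over the level `s`. -/
theorem IsRooted.exists_inner_near {A : Finset (Lattice d)} (hA : IsRooted A) {x : Lattice d}
    (hx : x ∈ A) {u : Space d} (hu : ‖u‖ = 1) {s : ℝ} (hs : 0 ≤ s)
    (hsx : s ≤ inner ℝ u (toSpace x)) : ∃ z ∈ A, |inner ℝ u (toSpace z) - s| ≤ 1 := by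
  have key : ∀ y, Relation.ReflTransGen (fun a b => b ∈ A ∧ IsNeighbor a b) 0 y →
      (∃ z ∈ A, |inner ℝ u (toSpace z) - s| ≤ 1) ∨ inner ℝ u (toSpace y) < s := by
    intro y hy
    induction hy with
    | refl =>
      rcases hs.eq_or_lt with rfl | h
      · exact Or.inl ⟨0, hA.1, by simp⟩
      · exact Or.inr (by simpa using h)
    | @tail b c _ hbc ih =>
      rcases ih with ih | ih
      · exact Or.inl ih
      · rcases lt_or_ge (inner ℝ u (toSpace c)) s with h | h
        · exact Or.inr h
        · refine Or.inl ⟨c, hbc.1, ?_⟩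
          have h1 := abs_real_inner_le_norm u (toSpace b - toSpace c)
          rw [hu, hbc.2, inner_sub_right, abs_le] at h1
          rw [abs_le]
          constructor <;> linarith
  rcases key x (hA.2 x hx) with h | h
  · exact h
  · exact absurd hsx h.not_ge

theorem le_rad_iff {A : Finset (Lattice d)} (hA : A.Nonempty) {R : ℝ} :
    R ≤ rad A ↔ ∃ x ∈ A, R ≤ ‖toSpace x‖ := by
  constructor
  · intro h
    obtain ⟨x, hx, hx'⟩ := A.exists_mem_eq_sup hA fun x => ‖toSpace x‖₊
    refine ⟨x, hx, h.trans ?_⟩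
    rw [rad, hx', coe_nnnorm]
  · rintro ⟨x, hx, h⟩
    refine h.trans ?_
    have : ‖toSpace x‖₊ ≤ A.sup fun x => ‖toSpace x‖₊ :=
      Finset.le_sup (f := fun x => ‖toSpace x‖₊) hx
    exact_mod_cast this

/-! ### Cubes and the lines that hit them -/

theorem isCompact_cube (z : Lattice d) : IsCompact (cube z) := by
  refine Metric.isCompact_of_isClosed_isBounded ?_ ?_
  · rw [cube, Set.ofPred_forall]
    exact isClosed_iInter fun i => isClosed_le (by fun_prop) continuous_const
  · refine (Metric.isBounded_closedBall (x := toSpace z) (r := d * (1 / 2))).subset fun x hx => ?_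
    rw [mem_closedBall_iff_norm]
    exact norm_le_of_abs_apply_le (by norm_num) hx

theorem convex_cube (z : Lattice d) : Convex ℝ (cube z) := by
  intro x hx y hy a b ha hb hab i
  have h : (a • x + b • y) i - z i = a * (x i - z i) + b * (y i - z i) := by
    have : (z i : ℝ) = a * z i + b * z i := by rw [← add_mul, hab, one_mul]
    simp only [PiLp.add_apply, PiLp.smul_apply, smul_eq_mul]
    linarith
  rw [h]
  refine (abs_add_le _ _).trans ?_
  rw [abs_mul, abs_mul, abs_of_nonneg ha, abs_of_nonneg hb]
  nlinarith [hx i, hy i]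

theorem measurableSet_hitting_cube (z : Lattice d) : MeasurableSet (hitting (cube z)) :=
  MeasurableSpace.measurableSet_generateFrom ⟨_, isCompact_cube z, convex_cube z, rfl⟩

theorem hitting_boxUnion (A : Finset (Lattice d)) :
    hitting (boxUnion A) = ⋃ z ∈ A, hitting (cube z) := by
  ext L
  simp only [hitting, boxUnion, Set.mem_ofPred_eq, Set.inter_iUnion, Set.nonempty_iUnion,
    Set.mem_iUnion, exists_prop]

theorem measurableSet_hitting_boxUnion (A : Finset (Lattice d)) :
    MeasurableSet (hitting (boxUnion A)) := by
  rw [hitting_boxUnion]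
  exact A.measurableSet_biUnion fun z _ => measurableSet_hitting_cube z

/-- In the slab of `perpVolume_eq`, a point `y` whose line meets the cube differs from the
projection of the cube's centre by less than `1/2` along `v` and by at most `d` across it. The bound
is uniform in `z` and `v`. -/
theorem perpVolume_hitting_cube_le (z : Lattice d) (v : Sphere d) :
    perpVolume (hitting (cube z)) v ≤ volume (Metric.ball (0 : Space d) (d + 1)) := by
  have hv : ‖(v : Space d)‖ = 1 := norm_eq_of_mem_sphere v
  rw [perpVolume_eq (measurableSet_hitting_cube z),
    ← Measure.addHaar_ball_center volume
      (toSpace z - inner ℝ (v : Space d) (toSpace z) • (v : Space d))]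
  refine measure_mono ?_
  rintro y ⟨hy, p, hp, hpz⟩
  rw [mem_points_lineThrough] at hp
  have hpz' : ‖p - toSpace z‖ ≤ d * (1 / 2) := norm_le_of_abs_apply_le (by norm_num) hpz
  have h1 := abs_real_inner_le_norm (v : Space d) (p - toSpace z)
  rw [hv, one_mul] at h1
  have h2 : y - (toSpace z - inner ℝ (v : Space d) (toSpace z) • (v : Space d))
      = inner ℝ (v : Space d) y • (v : Space d)
        + ((p - toSpace z) - inner ℝ (v : Space d) (p - toSpace z) • (v : Space d)) := by
    rw [inner_sub_right] at hp ⊢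
    have : y = p - (inner ℝ (v : Space d) p - inner ℝ (v : Space d) y) • (v : Space d) := by
      rw [← hp]; abel
    rw [sub_smul] at this ⊢
    nth_rewrite 1 [this]
    abel
  rw [mem_ball_iff_norm, h2]
  refine (norm_add_le _ _).trans_lt ?_
  have h3 := norm_sub_le (p - toSpace z)
    (inner ℝ (v : Space d) (p - toSpace z) • (v : Space d))
  rw [norm_smul, hv, mul_one, Real.norm_eq_abs] at *
  linarith

/-- The shadow of the cubes on the outer boundary of a rooted set contains disjoint balls whose
number is proportional to the distance from the origin to any point of the set whose position is
not almost parallel to the direction of projection. -/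
theorem le_perpVolume_hitting {A : Finset (Lattice d)} (hA : IsRooted A) {x : Lattice d}
    (hx : x ∈ A) (v : Sphere d)
    (hxv : |inner ℝ (v : Space d) (toSpace x)| ≤ 1 / 3 * ‖toSpace x‖) :
    ENNReal.ofReal (‖toSpace x‖ / (12 * d + 6)) * volume (Metric.ball (0 : Space d) (1 / 2)) ≤
      perpVolume (hitting (boxUnion (outerBoundary A))) v := by
  have hv : ‖(v : Space d)‖ = 1 := norm_eq_of_mem_sphere v
  rcases eq_or_ne (toSpace x) 0 with h0 | h0
  · simp [h0]
  have hx0 : 0 < ‖toSpace x‖ := norm_pos_iff.2 h0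
  have hvv : inner ℝ (v : Space d) (v : Space d) = (1 : ℝ) := by
    rw [real_inner_self_eq_norm_sq, hv, one_pow]
  -- `u` is the normalised component of `x` orthogonal to `v`; that component has squared length at
  -- least `8/9 ‖x‖²`, of which `1/4 ‖x‖²` is kept.
  obtain ⟨u, hu, huv, hux⟩ : ∃ u : Space d, ‖u‖ = 1 ∧ inner ℝ u (v : Space d) = (0 : ℝ) ∧
      ‖toSpace x‖ / 2 ≤ inner ℝ u (toSpace x) := by
    let w := toSpace x - inner ℝ (v : Space d) (toSpace x) • (v : Space d)
    have hwv : inner ℝ w (v : Space d) = (0 : ℝ) := by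
      rw [inner_sub_left, real_inner_smul_left, hvv, real_inner_comm]; ring
    have hwx : inner ℝ w (toSpace x)
        = ‖toSpace x‖ ^ 2 - inner ℝ (v : Space d) (toSpace x) ^ 2 := by
      rw [inner_sub_left, real_inner_smul_left, real_inner_self_eq_norm_sq]; ring
    have hww : ‖w‖ ^ 2 = inner ℝ w (toSpace x) := by
      rw [← real_inner_self_eq_norm_sq]
      conv_lhs => rw [show w = toSpace x - inner ℝ (v : Space d) (toSpace x) • (v : Space d)
        from rfl]
      rw [inner_sub_right, real_inner_smul_right]
      change inner ℝ w (toSpace x) - _ * inner ℝ w (v : Space d) = _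
      rw [hwv]; ring
    have hsq : inner ℝ (v : Space d) (toSpace x) ^ 2 ≤ (1 / 3 * ‖toSpace x‖) ^ 2 := by
      rw [← sq_abs]; gcongr
    have hw2 : (‖toSpace x‖ / 2) ^ 2 ≤ ‖w‖ ^ 2 := by rw [hww, hwx]; nlinarith
    have hw : ‖toSpace x‖ / 2 ≤ ‖w‖ := le_of_sq_le_sq hw2 (norm_nonneg _)
    have hw0 : 0 < ‖w‖ := by linarith
    refine ⟨‖w‖⁻¹ • w, ?_, ?_, ?_⟩
    · rw [norm_smul, norm_inv, norm_norm, inv_mul_cancel₀ hw0.ne']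
    · rw [real_inner_smul_left, hwv, mul_zero]
    · rw [real_inner_smul_left, ← hww]
      field_simp
      linarith
  -- The levels `k (6 d + 3)`, `k < N`, do not exceed `‖x‖ / 2`. Boundary points are found within `3
  -- d + 1` of them (`3 d` from the ray, `1` from the path), so distinct ones stay at least `1`
  -- apart along `u`, which makes balls of radius `1/2` disjoint.
  set N : ℕ := ⌊‖toSpace x‖ / (12 * d + 6)⌋₊ + 1 with hN
  have hL : (0 : ℝ) < 12 * d + 6 := by positivity
  have hpt : ∀ k : ℕ, k < N → ∃ w ∈ outerBoundary A,
      |inner ℝ u (toSpace w) - k * (6 * d + 3)| ≤ 3 * d + 1 := by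
    intro k hk
    have hk' : (k : ℝ) ≤ ‖toSpace x‖ / (12 * d + 6) :=
      (Nat.le_floor_iff (by positivity)).1 (by omega)
    rw [le_div_iff₀ hL] at hk'
    obtain ⟨z, hz, hzs⟩ := hA.exists_inner_near hx hu (s := k * (6 * d + 3)) (by positivity)
      (by linarith)
    obtain ⟨w, hw, t, ht⟩ := exists_mem_outerBoundary_near_ray hz hv
    refine ⟨w, hw, ?_⟩
    have h1 := abs_real_inner_le_norm u (toSpace w - (toSpace z + t • (v : Space d)))
    rw [hu, inner_sub_right, inner_add_right, real_inner_smul_right, huv] at h1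
    have h2 := abs_le.1 (h1.trans (by linarith : _ ≤ (3 * d : ℝ)))
    rw [abs_le] at hzs ⊢
    constructor <;> linarith
  choose! w hw hwu using hpt
  let c : ℕ → Space d := fun k =>
    toSpace (w k) - inner ℝ (v : Space d) (toSpace (w k)) • (v : Space d)
  have hcv : ∀ k, inner ℝ (v : Space d) (c k) = (0 : ℝ) := fun k => by
    simp only [c]; rw [inner_sub_right, real_inner_smul_right, hvv]; ring
  have hcu : ∀ k, inner ℝ u (c k) = (inner ℝ u (toSpace (w k)) : ℝ) := fun k => by
    simp only [c]; rw [inner_sub_right, real_inner_smul_right, huv]; ring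
  -- Translating `y` along its own line by the component of `w k` along `v` carries the ball around
  -- `c k` to the ball around `w k`, which lies in the cube.
  have hsub : (⋃ k ∈ Finset.range N, Metric.ball (c k) (1 / 2)) ⊆
      {y | |inner ℝ (v : Space d) y| < 1 / 2 ∧
        lineThrough v y ∈ hitting (boxUnion (outerBoundary A))} := by
    intro y hy
    simp only [Set.mem_iUnion, Finset.mem_range, mem_ball_iff_norm, exists_prop] at hy
    obtain ⟨k, hk, hy⟩ := hy
    refine ⟨?_, ?_⟩
    · have h1 := abs_real_inner_le_norm (v : Space d) (y - c k)
      rw [inner_sub_right, hcv, hv, sub_zero, one_mul] at h1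
      exact h1.trans_lt hy
    · rw [hitting_boxUnion]
      refine Set.mem_biUnion (hw k hk)
        ⟨y + inner ℝ (v : Space d) (toSpace (w k)) • (v : Space d), ?_, fun i => ?_⟩
      · rw [mem_points_lineThrough, add_sub_cancel_left, real_inner_smul_right, hvv, mul_one]
      · have h1 : y + inner ℝ (v : Space d) (toSpace (w k)) • (v : Space d) - toSpace (w k)
            = y - c k := by simp only [c]; abel
        have h2 := PiLp.norm_apply_le (y - c k) i
        rw [← h1] at h2
        exact h2.trans (h1 ▸ hy.le)
  have hdisj : (↑(Finset.range N) : Set ℕ).PairwiseDisjoint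
      fun k => Metric.ball (c k) (1 / 2) := by
    intro k hk l hl hkl
    refine Metric.ball_disjoint_ball ?_
    rw [dist_eq_norm]
    have h1 := abs_real_inner_le_norm u (c k - c l)
    rw [inner_sub_right, hcu, hcu, hu, one_mul] at h1
    refine le_trans ?_ h1
    have h2 := abs_le.1 (hwu k (by simpa using hk))
    have h3 := abs_le.1 (hwu l (by simpa using hl))
    rcases lt_or_gt_of_ne hkl with h | h
    · have h4 : (k : ℝ) + 1 ≤ l := by exact_mod_cast h
      rw [le_abs]; right
      nlinarith
    · have h4 : (l : ℝ) + 1 ≤ k := by exact_mod_cast h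
      rw [le_abs]; left
      nlinarith
  rw [perpVolume_eq (measurableSet_hitting_boxUnion _)]
  refine le_trans ?_ (measure_mono hsub)
  rw [measure_biUnion_finset hdisj fun k _ => measurableSet_ball]
  simp only [Measure.addHaar_ball_center, Finset.sum_const, Finset.card_range, nsmul_eq_mul]
  gcongr
  refine ENNReal.ofReal_le_of_le_toReal ?_
  rw [ENNReal.toReal_natCast, hN]
  exact_mod_cast (Nat.lt_floor_add_one _).le

/-! ### The bound on the ballistic measure -/

theorem exists_unit_inner_eq_zero (hd : 2 ≤ d) (x : Space d) :
    ∃ e : Sphere d, inner ℝ (e : Space d) x = (0 : ℝ) := by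
  have h1 : Module.finrank ℝ (ℝ ∙ x) ≤ 1 := by
    simpa using finrank_span_le_card (R := ℝ) ({x} : Set (Space d))
  have h2 := Submodule.finrank_add_finrank_orthogonal (ℝ ∙ x)
  rw [finrank_euclideanSpace_fin] at h2
  have : Nontrivial (ℝ ∙ x)ᗮ := Module.nontrivial_of_finrank_pos (R := ℝ) (by omega)
  obtain ⟨e, he⟩ := NormedSpace.sphere_nonempty (E := (ℝ ∙ x)ᗮ) (x := 0) (r := 1) |>.2 zero_le_one
  refine ⟨⟨e, by simpa using he⟩, ?_⟩
  exact Submodule.mem_orthogonal_singleton_iff_inner_left.1 e.2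

/-- The mass of the directions that are far from the direction of a given vector is bounded
away from zero. -/
theorem exists_le_sphereUniform (hd : 2 ≤ d) : ∃ c : ℝ≥0∞, c ≠ 0 ∧ ∀ x : Space d,
    c ≤ sphereUniform d {v | |inner ℝ (v : Space d) x| ≤ 1 / 3 * ‖x‖} := by
  refine ⟨((volume : Measure (Space d)).toSphere Set.univ)⁻¹ *
    (Measure.toSphereBallBound (Module.finrank ℝ (Space d)) (1 / 3) *
      volume (Metric.ball (0 : Space d) 1)), ?_, fun x => ?_⟩
  · refine mul_ne_zero (ENNReal.inv_ne_zero.2 (measure_ne_top _ _)) (mul_ne_zero ?_ ?_)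
    · exact_mod_cast (Measure.toSphereBallBound_pos _ _).ne'
    · exact (Metric.measure_ball_pos _ _ one_pos).ne'
  -- For `e` orthogonal to `x`, the cap of radius `1/3` around `e` consists of admissible
  -- directions, since `⟨v, x⟩ = ⟨v - e, x⟩`. Its mass has a lower bound independent of `e`.
  · obtain ⟨e, he⟩ := exists_unit_inner_eq_zero hd x
    rw [sphereUniform, Measure.smul_apply, smul_eq_mul]
    gcongr
    refine (Measure.toSphereBallBound_mul_measure_unitBall_le_toSphere_ball _
      (by norm_num) e).trans (measure_mono fun v hv => ?_)
    have h1 := abs_real_inner_le_norm ((v : Space d) - e) x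
    rw [inner_sub_left, he, sub_zero] at h1
    refine h1.trans ?_
    have h2 : ‖(v : Space d) - e‖ ≤ 1 / 3 := by
      rw [← dist_eq_norm]; exact (Metric.mem_ball.1 hv).le
    gcongr

theorem sphereUniform_univ_le (d : ℕ) : sphereUniform d Set.univ ≤ 1 := by
  rw [sphereUniform, Measure.smul_apply, smul_eq_mul]
  exact ENNReal.inv_mul_le_one _

theorem lineMeasure_hitting_cube_le (z : Lattice d) :
    lineMeasure d (hitting (cube z)) ≤ volume (Metric.ball (0 : Space d) (d + 1)) := by
  rw [lineMeasure_apply (measurableSet_hitting_cube z)]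
  refine (lintegral_mono fun v => perpVolume_hitting_cube_le z v).trans ?_
  rw [lintegral_const]
  exact mul_le_of_le_one_right' (sphereUniform_univ_le d)

/-- Markov's inequality over directions: those far from the direction of `x` have mass bounded
below, and each has a shadow of size at least of order `‖x‖`. -/
theorem exists_le_lineMeasure_hitting (hd : 2 ≤ d) : ∃ c : ℝ≥0∞, c ≠ 0 ∧
    ∀ A : Finset (Lattice d), IsRooted A → ∀ x ∈ A,
      ENNReal.ofReal ‖toSpace x‖ * c ≤
        lineMeasure d (hitting (boxUnion (outerBoundary A))) := by
  obtain ⟨c, hc, hcx⟩ := exists_le_sphereUniform hd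
  have hL : (0 : ℝ) < 12 * d + 6 := by positivity
  refine ⟨(ENNReal.ofReal (12 * d + 6))⁻¹ * volume (Metric.ball (0 : Space d) (1 / 2)) * c,
    mul_ne_zero (mul_ne_zero (by simp) (Metric.measure_ball_pos _ _ (by norm_num)).ne') hc,
    fun A hA x hx => ?_⟩
  have hB := measurableSet_hitting_boxUnion (outerBoundary A)
  rw [lineMeasure_apply hB]
  refine le_trans ?_ (mul_meas_ge_le_lintegral (measurable_perpVolume hB)
    (ENNReal.ofReal (‖toSpace x‖ / (12 * d + 6)) * volume (Metric.ball (0 : Space d) (1 / 2))))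
  rw [← mul_assoc, ← mul_assoc]
  rw [← div_eq_mul_inv, ← ENNReal.ofReal_div_of_pos hL]
  refine mul_le_mul_right ((hcx (toSpace x)).trans (measure_mono ?_)) _
  exact fun v hv => le_perpVolume_hitting hA hx v hv

theorem mem_hitPoints {A : Finset (Lattice d)} {L : Line d} {z : Lattice d} :
    z ∈ hitPoints A L ↔ z ∈ A ∧ L ∈ hitting (cube z) := by
  classical
  exact Finset.mem_filter

theorem ballisticWeight_le_indicator (A : Finset (Lattice d)) (z : Lattice d) (L : Line d) :
    ballisticWeight A z L ≤ (hitting (cube z)).indicator 1 L := by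
  have h : z ∈ hitPoints A L → L ∈ hitting (cube z) := fun h => (mem_hitPoints.1 h).2
  unfold ballisticWeight
  split_ifs with h1 h2
  · rw [Set.indicator_of_mem (h (by simp [h1]))]; rfl
  · rw [Set.indicator_of_mem (h (h2.2.elim (fun h => h.1) fun h => h.1))]
    simp
  · exact zero_le

theorem ballisticMeasure_eq_zero {A : Finset (Lattice d)} {z : Lattice d} (hz : z ∉ A) :
    ballisticMeasure A z = 0 := by
  have h : ∀ L, z ∉ hitPoints A L := fun L h => hz (mem_hitPoints.1 h).1
  refine (lintegral_congr fun L => ?_).trans lintegral_zero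
  rw [ballisticWeight, if_neg, if_neg]
  · rintro ⟨-, h1 | h1⟩ <;> exact h L h1.1
  · intro h1; exact h L (by simp [h1])

/-- Only lines through the cube of `z` charge `z`, each with weight at most one; the order of the
visits plays no role. -/
theorem ballisticMeasure_le (A : Finset (Lattice d)) (z : Lattice d) :
    ballisticMeasure A z ≤
      lineMeasure d (hitting (cube z)) / lineMeasure d (hitting (boxUnion A)) := by
  have hz := measurableSet_hitting_cube z
  refine (lintegral_mono (ballisticWeight_le_indicator A z)).trans ?_
  rw [lintegral_indicator_one hz, isotropicLine, cond_apply' hz, ENNReal.div_eq_inv_mul]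
  gcongr
  exact Set.inter_subset_right

/-- The ballistic measure of a point of the outer boundary of a rooted set is at most
inversely proportional to the radius of the set. -/
theorem exists_ballisticMeasure_le (hd : 2 ≤ d) : ∃ C : ℝ, 0 < C ∧
    ∀ A : Finset (Lattice d), IsRooted A → ∀ R, 0 < R → R ≤ rad A →
      ∀ z, ballisticMeasure (outerBoundary A) z ≤ ENNReal.ofReal (C / R) := by
  obtain ⟨c, hc, hcA⟩ := exists_le_lineMeasure_hitting hd
  let M := volume (Metric.ball (0 : Space d) (d + 1))
  have hM : M / c ≠ ∞ := ENNReal.div_ne_top measure_ball_lt_top.ne hc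
  refine ⟨(M / c).toReal + 1, by positivity, fun A hA R hR hRA z => ?_⟩
  obtain ⟨x, hx, hRx⟩ := (le_rad_iff ⟨0, hA.1⟩).1 hRA
  refine (ballisticMeasure_le _ z).trans ?_
  calc _ ≤ M / (ENNReal.ofReal R * c) := by
        refine ENNReal.div_le_div (lineMeasure_hitting_cube_le z) (le_trans ?_ (hcA A hA x hx))
        gcongr
    _ = M / c / ENNReal.ofReal R := by
        rw [div_eq_mul_inv, div_eq_mul_inv, div_eq_mul_inv,
          ENNReal.mul_inv (Or.inl (by simpa using hR)) (Or.inl ENNReal.ofReal_ne_top),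
          mul_comm (ENNReal.ofReal R)⁻¹, mul_assoc]
    _ ≤ _ := by
        rw [ENNReal.ofReal_div_of_pos hR]
        gcongr
        exact (ENNReal.le_ofReal_iff_toReal_le hM (by positivity)).2 (by linarith)

/-! ### An exponential functional of finite sets -/

/-- The weight `exp (‖z‖ - R)⁺`. -/
def expWeight (R : ℝ) (z : Lattice d) : ℝ≥0∞ :=
  ENNReal.ofReal (Real.exp (max (‖toSpace z‖ - R) 0))

/-- The total weight of a finite set. -/
def totalWeight (R : ℝ) (A : Finset (Lattice d)) : ℝ≥0∞ := ∑ x ∈ A, expWeight R x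

theorem IsNeighbor.norm_le {x y : Lattice d} (h : IsNeighbor x y) :
    ‖toSpace y‖ ≤ ‖toSpace x‖ + 1 := by
  have h1 := norm_sub_norm_le (toSpace y) (toSpace x)
  rw [norm_sub_rev, h] at h1
  linarith

theorem IsNeighbor.expWeight_le {x y : Lattice d} (h : IsNeighbor x y) (R : ℝ) :
    expWeight R y ≤ ENNReal.ofReal (Real.exp 1) * expWeight R x := by
  rw [expWeight, expWeight, ← ENNReal.ofReal_mul (Real.exp_pos _).le, ← Real.exp_add]
  refine ENNReal.ofReal_le_ofReal (Real.exp_le_exp.2 (max_le ?_ ?_))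
  · linarith [h.norm_le, le_max_left (‖toSpace x‖ - R) 0]
  · linarith [le_max_right (‖toSpace x‖ - R) 0]

theorem totalWeight_union_singleton_le (R : ℝ) (A : Finset (Lattice d)) (z : Lattice d) :
    totalWeight R (A ∪ {z}) ≤ totalWeight R A + expWeight R z := by
  classical
  calc totalWeight R (A ∪ {z})
      ≤ ∑ x ∈ A ∪ {z}, expWeight R x + ∑ x ∈ A ∩ {z}, expWeight R x := le_self_add
    _ = _ := by rw [Finset.sum_union_inter, Finset.sum_singleton, totalWeight]

/-- Each boundary point is charged to a neighbour in `A`. A point has at most `3 ^ d` neighbours,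
and a unit step raises the weight by at most a factor `e`. -/
theorem sum_outerBoundary_expWeight_le (R : ℝ) (A : Finset (Lattice d)) :
    ∑ z ∈ outerBoundary A, expWeight R z ≤
      3 ^ d * ENNReal.ofReal (Real.exp 1) * totalWeight R A := by
  classical
  let N : Lattice d → Finset (Lattice d) :=
    fun x => (Finset.Icc (x - 1) (x + 1)).filter (IsNeighbor x)
  have hsub : outerBoundary A ⊆ (A.sigma N).image Sigma.snd := by
    intro y hy
    obtain ⟨-, x, hx, hxy⟩ := mem_outerBoundary.1 hy
    exact Finset.mem_image.2
      ⟨⟨x, y⟩, by simpa [N, hx, hxy] using Finset.mem_Icc.1 hxy.mem_Icc, rfl⟩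
  refine (Finset.sum_le_sum_of_subset hsub).trans ?_
  refine (Finset.sum_image_le_of_nonneg fun _ _ => zero_le).trans ?_
  rw [Finset.sum_sigma, totalWeight, Finset.mul_sum]
  refine Finset.sum_le_sum fun x _ => ?_
  refine (Finset.sum_le_card_nsmul _ _ _ fun y hy =>
    (Finset.mem_filter.1 hy).2.expWeight_le R).trans ?_
  rw [nsmul_eq_mul, mul_assoc]
  gcongr
  exact_mod_cast (Finset.card_filter_le _ _).trans (card_Icc_neighborhood x).le

theorem ofReal_exp_le_totalWeight {R : ℝ} {A : Finset (Lattice d)} (hA : A.Nonempty)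
    (h : 2 * R ≤ rad A) : ENNReal.ofReal (Real.exp R) ≤ totalWeight R A := by
  obtain ⟨x, hx, hRx⟩ := (le_rad_iff hA).1 h
  refine le_trans ?_ (Finset.single_le_sum (fun _ _ => zero_le) hx)
  refine ENNReal.ofReal_le_ofReal (Real.exp_le_exp.2 (le_max_of_le_left ?_))
  linarith

theorem totalWeight_singleton_zero {R : ℝ} (hR : 0 ≤ R) :
    totalWeight R ({0} : Finset (Lattice d)) = 1 := by
  simp [totalWeight, expWeight, hR]

/-- The expected total weight after one step of an aggregation whose distributions are at most
inversely proportional to the radius. -/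
theorem tsum_mul_totalWeight_le {A : Finset (Lattice d)} (hA : A.Nonempty)
    {p : Lattice d → ℝ≥0∞} (hp : ∑' z, p z ≤ 1) (hpA : ∀ z ∉ outerBoundary A, p z = 0)
    {C R : ℝ} (hC : 0 ≤ C) (hR : 0 < R) (hpC : R ≤ rad A → ∀ z, p z ≤ ENNReal.ofReal (C / R)) :
    ∑' z, p z * totalWeight R (A ∪ {z}) ≤
      (1 + ENNReal.ofReal (C * 3 ^ d * Real.exp 1 / R)) * totalWeight R A
        + ENNReal.ofReal (Real.exp 1) := by
  have hg : ∑' z, p z * expWeight R z ≤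
      ENNReal.ofReal (C * 3 ^ d * Real.exp 1 / R) * totalWeight R A
        + ENNReal.ofReal (Real.exp 1) := by
    rw [tsum_eq_sum (s := outerBoundary A) fun z hz => by rw [hpA z hz, zero_mul]]
    -- For radius at least `R` the bound `C / R` on the point masses yields the multiplicative term.
    -- Otherwise the new point has norm below `R + 1`, hence weight at most `e`.
    rcases le_or_gt R (rad A) with h | h
    · refine le_add_right ?_
      calc ∑ z ∈ outerBoundary A, p z * expWeight R z
          ≤ ∑ z ∈ outerBoundary A, ENNReal.ofReal (C / R) * expWeight R z :=
            Finset.sum_le_sum fun z _ => mul_le_mul_left (hpC h z) _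
        _ ≤ ENNReal.ofReal (C / R) * (3 ^ d * ENNReal.ofReal (Real.exp 1) * totalWeight R A) := by
            rw [← Finset.mul_sum]
            exact mul_le_mul_right (sum_outerBoundary_expWeight_le R A) _
        _ = _ := by
            have h3 : (3 ^ d : ℝ≥0∞) = ENNReal.ofReal (3 ^ d) := by
              rw [ENNReal.ofReal_pow (by norm_num)]; simp
            rw [h3, ← ENNReal.ofReal_mul (by positivity), ← mul_assoc,
              ← ENNReal.ofReal_mul (by positivity)]
            congr 2
            ring
    · refine le_add_left ?_
      calc ∑ z ∈ outerBoundary A, p z * expWeight R z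
          ≤ ∑ z ∈ outerBoundary A, p z * ENNReal.ofReal (Real.exp 1) := by
            refine Finset.sum_le_sum fun z hz => mul_le_mul_right ?_ _
            obtain ⟨-, x, hx, hxz⟩ := mem_outerBoundary.1 hz
            have hxR : ‖toSpace x‖ < R := by
              by_contra! hxR
              exact h.not_ge ((le_rad_iff hA).2 ⟨x, hx, hxR⟩)
            refine ENNReal.ofReal_le_ofReal (Real.exp_le_exp.2 (max_le ?_ zero_le_one))
            linarith [hxz.norm_le]
        _ ≤ 1 * ENNReal.ofReal (Real.exp 1) := by
            rw [← Finset.sum_mul]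
            exact mul_le_mul_left ((ENNReal.sum_le_tsum _).trans hp) _
        _ = _ := one_mul _
  calc ∑' z, p z * totalWeight R (A ∪ {z})
      ≤ ∑' z, (p z * totalWeight R A + p z * expWeight R z) :=
        ENNReal.tsum_le_tsum fun z => by
          rw [← mul_add]
          exact mul_le_mul_right (totalWeight_union_singleton_le R A z) _
    _ = (∑' z, p z) * totalWeight R A + ∑' z, p z * expWeight R z := by
        rw [ENNReal.tsum_add, ENNReal.tsum_mul_right]
    _ ≤ 1 * totalWeight R A + (ENNReal.ofReal (C * 3 ^ d * Real.exp 1 / R) * totalWeight R A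
        + ENNReal.ofReal (Real.exp 1)) := add_le_add (mul_le_mul_left hp _) hg
    _ = _ := by rw [add_mul, add_assoc]

/-! ### Growth of ballistic aggregation -/

theorem lintegral_comp_eq_tsum {Ω ι : Type*} [MeasurableSpace Ω] [Countable ι] (P : Measure Ω)
    {X : Ω → ι} (hX : ∀ i, MeasurableSet {ω | X ω = i}) (f : ι → ℝ≥0∞) :
    ∫⁻ ω, f (X ω) ∂P = ∑' i, f i * P {ω | X ω = i} := by
  let _ : MeasurableSpace ι := ⊤
  have hXm : Measurable X := measurable_to_countable' fun i => hX i
  rw [← lintegral_map (measurable_from_top (f := f)) hXm, lintegral_countable']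
  refine tsum_congr fun i => ?_
  rw [Measure.map_apply hXm (measurableSet_singleton i)]
  rfl

theorem IsIncrementalAggregation.measurableSet_eq {Ω : Type*} [MeasurableSpace Ω] {P : Measure Ω}
    {F : ℕ → Ω → Finset (Lattice d)} {μ : Finset (Lattice d) → Lattice d → ℝ≥0∞}
    (hF : IsIncrementalAggregation μ P F) {n : ℕ} (hn : 1 ≤ n) (A : Finset (Lattice d)) :
    MeasurableSet {ω | F n ω = A} :=
  hF.measurable n hn (show MeasurableSet[⊤] {A} from trivial)

section Growth

variable {Ω : Type*} [MeasurableSpace Ω] {P : Measure Ω} [IsProbabilityMeasure P]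
  {F : ℕ → Ω → Finset (Lattice d)}

/-- The mean of a functional of the set after one more step. -/
theorem IsIncrementalAggregation.lintegral_succ
    {μ : Finset (Lattice d) → Lattice d → ℝ≥0∞} (hF : IsIncrementalAggregation μ P F) {n : ℕ}
    (hn : 1 ≤ n) (f : Finset (Lattice d) → ℝ≥0∞) :
    ∫⁻ ω, f (F (n + 1) ω) ∂P =
      ∑' A, P {ω | F n ω = A} * ∑' z, μ (outerBoundary A) z * f (A ∪ {z}) := by
  obtain ⟨y, hy⟩ := hF.step
  obtain ⟨hym, hyF, hyc⟩ := hy n hn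
  have hym' : ∀ z, MeasurableSet {ω | y (n + 1) ω = z} :=
    fun z => hym (measurableSet_singleton z)
  have hX : ∀ q : Finset (Lattice d) × Lattice d,
      {ω | (F n ω, y (n + 1) ω) = q} = {ω | F n ω = q.1} ∩ {ω | y (n + 1) ω = q.2} := fun q => by
    ext ω
    exact Prod.ext_iff
  simp only [hyF]
  rw [lintegral_comp_eq_tsum P (X := fun ω => (F n ω, y (n + 1) ω)) (fun q => by
      rw [hX]; exact (hF.measurableSet_eq hn _).inter (hym' _)) (fun q => f (q.1 ∪ {q.2})),
    ENNReal.tsum_prod']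
  refine tsum_congr fun A => ?_
  rw [← ENNReal.tsum_mul_left]
  refine tsum_congr fun z => ?_
  rw [hX, mul_comm, ← mul_assoc]
  congr 1
  by_cases hA : P {ω | F n ω = A} = 0
  · rw [hA, zero_mul]
    exact measure_mono_null Set.inter_subset_left hA
  · rw [← hyc A hA z, cond_apply (hF.measurableSet_eq hn A), ← mul_assoc,
      ENNReal.mul_inv_cancel hA (measure_ne_top _ _), one_mul]

/-- The masses are those of a conditional law, so the bound comes from the process and the total
ballistic mass need not be computed. -/
theorem IsIncrementalAggregation.tsum_le_one
    {μ : Finset (Lattice d) → Lattice d → ℝ≥0∞} (hF : IsIncrementalAggregation μ P F) {n : ℕ}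
    (hn : 1 ≤ n) {A : Finset (Lattice d)} (hA : P {ω | F n ω = A} ≠ 0) :
    ∑' z, μ (outerBoundary A) z ≤ 1 := by
  obtain ⟨y, hy⟩ := hF.step
  obtain ⟨hym, -, hyc⟩ := hy n hn
  have := cond_isProbabilityMeasure hA
  have h := lintegral_comp_eq_tsum P[|{ω | F n ω = A}] (X := y (n + 1))
    (fun z => hym (measurableSet_singleton z)) 1
  simp only [Pi.one_apply, one_mul, hyc A hA, lintegral_one, measure_univ] at h
  exact h.ge

/-- The possible values of ballistic aggregation at time `n` are rooted sets of `n` points. -/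
theorem IsBallisticAggregation.isRooted_and_card (hF : IsBallisticAggregation P F) {n : ℕ}
    (hn : 1 ≤ n) : ∀ A, P {ω | F n ω = A} ≠ 0 → IsRooted A ∧ A.card = n := by
  classical
  induction n, hn using Nat.le_induction with
  | base =>
    intro A hA
    obtain ⟨ω, hω⟩ := nonempty_of_measure_ne_zero hA
    rw [← show F 1 ω = A from hω, hF.init]
    exact ⟨isRooted_singleton_zero, Finset.card_singleton _⟩
  | succ n hn ih =>
    intro B hB
    have h := IsIncrementalAggregation.lintegral_succ hF hn (Set.indicator {B} 1)
    have h1 : ∫⁻ ω, Set.indicator {B} 1 (F (n + 1) ω) ∂P = P {ω | F (n + 1) ω = B} := by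
      rw [← lintegral_indicator_one (hF.measurableSet_eq (by omega) B)]
      rfl
    rw [h1] at h
    rw [h] at hB
    simp only [ne_eq, ENNReal.tsum_eq_zero, mul_eq_zero, Set.indicator_apply_eq_zero,
      not_forall, not_or] at hB
    obtain ⟨A, hA, z, hz, hAB, -⟩ := hB
    have hz' : z ∈ outerBoundary A := by
      by_contra hz'
      exact hz (ballisticMeasure_eq_zero hz')
    obtain ⟨hr, hc⟩ := ih A hA
    rw [← Set.mem_singleton_iff.1 hAB]
    refine ⟨hr.union_singleton hz', ?_⟩
    rw [Finset.card_union_of_disjoint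
      (Finset.disjoint_singleton_right.2 (mem_outerBoundary.1 hz').1), hc,
      Finset.card_singleton]

theorem IsBallisticAggregation.ae_isRooted_and_card (hF : IsBallisticAggregation P F) {n : ℕ}
    (hn : 1 ≤ n) : ∀ᵐ ω ∂P, IsRooted (F n ω) ∧ (F n ω).card = n := by
  have h : ∀ᵐ ω ∂P, ∀ A : Finset (Lattice d), P {ω | F n ω = A} = 0 → F n ω ≠ A := by
    refine ae_all_iff.2 fun A => ?_
    by_cases hA : P {ω | F n ω = A} = 0
    · filter_upwards [measure_eq_zero_iff_ae_notMem.1 hA] with ω hω _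
      exact hω
    · exact Eventually.of_forall fun ω h => absurd h hA
  filter_upwards [h] with ω hω
  exact hF.isRooted_and_card hn _ fun h0 => hω _ h0 rfl

theorem IsBallisticAggregation.lintegral_totalWeight_le (hF : IsBallisticAggregation P F)
    {C R : ℝ} (hC : 0 ≤ C) (hR : 0 < R)
    (hCR : ∀ A : Finset (Lattice d), IsRooted A → R ≤ rad A →
      ∀ z, ballisticMeasure (outerBoundary A) z ≤ ENNReal.ofReal (C / R)) {n : ℕ} (hn : 1 ≤ n) :
    ∫⁻ ω, totalWeight R (F n ω) ∂P ≤
      (1 + ENNReal.ofReal (C * 3 ^ d * Real.exp 1 / R)) ^ n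
        * (1 + n * ENNReal.ofReal (Real.exp 1)) := by
  set q := 1 + ENNReal.ofReal (C * 3 ^ d * Real.exp 1 / R)
  have hq : 1 ≤ q := le_self_add
  set e := ENNReal.ofReal (Real.exp 1)
  induction n, hn using Nat.le_induction with
  | base =>
    simp only [hF.init, totalWeight_singleton_zero hR.le, lintegral_one, measure_univ, pow_one]
    exact one_le_mul hq le_self_add
  | succ n hn ih =>
    have hsum : ∑' A, P {ω | F n ω = A} = 1 := by
      have h := lintegral_comp_eq_tsum P (X := F n) (hF.measurableSet_eq hn) 1
      simpa using h.symm
    rw [IsIncrementalAggregation.lintegral_succ hF hn]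
    calc _ ≤ ∑' A, P {ω | F n ω = A} * (q * totalWeight R A + e) := by
          refine ENNReal.tsum_le_tsum fun A => ?_
          by_cases hA : P {ω | F n ω = A} = 0
          · simp [hA]
          · have hr := (hF.isRooted_and_card hn A hA).1
            exact mul_le_mul_right (tsum_mul_totalWeight_le ⟨0, hr.1⟩
              (IsIncrementalAggregation.tsum_le_one hF hn hA)
              (fun z => ballisticMeasure_eq_zero) hC hR (hCR A hr)) _
      _ = q * ∫⁻ ω, totalWeight R (F n ω) ∂P + e := by
          rw [lintegral_comp_eq_tsum P (hF.measurableSet_eq hn), ← ENNReal.tsum_mul_left]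
          simp only [mul_add]
          rw [ENNReal.tsum_add, ENNReal.tsum_mul_right, hsum, one_mul]
          congr 1
          exact tsum_congr fun A => by ring
      -- As `q ≥ 1`, the summand `e` may be inflated by `q ^ (n + 1)`, which closes the induction.
      _ ≤ q * (q ^ n * (1 + n * e)) + q ^ (n + 1) * e := by
          gcongr
          exact le_mul_of_one_le_left' (one_le_pow₀ hq)
      _ = _ := by push_cast; ring

/-- A tail bound for the radius of ballistic aggregation. -/
theorem IsBallisticAggregation.measure_le_rad_le (hF : IsBallisticAggregation P F)
    {C R : ℝ} (hC : 0 ≤ C) (hR : 0 < R)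
    (hCR : ∀ A : Finset (Lattice d), IsRooted A → R ≤ rad A →
      ∀ z, ballisticMeasure (outerBoundary A) z ≤ ENNReal.ofReal (C / R)) {n : ℕ} (hn : 1 ≤ n) :
    P {ω | 2 * R ≤ rad (F n ω)} ≤ ENNReal.ofReal
      (Real.exp (n * (C * 3 ^ d * Real.exp 1 / R) - R) * (1 + n * Real.exp 1)) := by
  set a := C * 3 ^ d * Real.exp 1 / R with ha
  have ha0 : 0 ≤ a := by positivity
  have hm : Measurable fun ω => totalWeight R (F n ω) :=
    (measurable_from_top (f := totalWeight R)).comp (hF.measurable n hn)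
  have h1 : P {ω | 2 * R ≤ rad (F n ω)} ≤
      P {ω | ENNReal.ofReal (Real.exp R) ≤ totalWeight R (F n ω)} := by
    refine measure_mono_ae ?_
    filter_upwards [hF.ae_isRooted_and_card hn] with ω hω h
    exact ofReal_exp_le_totalWeight ⟨0, hω.1.1⟩ h
  have hpos : 0 < Real.exp R := Real.exp_pos R
  -- Markov's inequality at level `exp R`; afterwards `1 + a ≤ exp a` turns the power into an
  -- exponential.
  refine h1.trans ((meas_ge_le_lintegral_div hm.aemeasurable (by simpa using hpos)
    ENNReal.ofReal_ne_top).trans ?_)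
  have h2 : (1 + ENNReal.ofReal a) ^ n * (1 + n * ENNReal.ofReal (Real.exp 1))
      = ENNReal.ofReal ((1 + a) ^ n * (1 + n * Real.exp 1)) := by
    rw [ENNReal.ofReal_mul (by positivity), ENNReal.ofReal_pow (by positivity),
      ENNReal.ofReal_add zero_le_one ha0, ENNReal.ofReal_add zero_le_one (by positivity),
      ENNReal.ofReal_mul (by positivity), ENNReal.ofReal_natCast, ENNReal.ofReal_one]
  refine (ENNReal.div_le_div_right (hF.lintegral_totalWeight_le hC hR hCR hn) _).trans ?_
  rw [h2, ← ENNReal.ofReal_div_of_pos hpos]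
  refine ENNReal.ofReal_le_ofReal ?_
  rw [Real.exp_sub, Real.exp_nat_mul, div_mul_eq_mul_div]
  gcongr
  linarith [Real.add_one_le_exp a]

theorem summable_exp_neg_sqrt_mul :
    Summable fun n : ℕ => Real.exp (-√n) * (1 + n * Real.exp 1) := by
  have hs : Summable fun n : ℕ => (Nat.factorial 8 * (1 + Real.exp 1)) * (1 / (n : ℝ) ^ 3) :=
    (Real.summable_one_div_nat_pow.2 (by norm_num)).mul_left _
  refine hs.of_norm_bounded_eventually_nat ?_
  filter_upwards [eventually_ge_atTop 1] with n hn
  have hn' : (1 : ℝ) ≤ n := by exact_mod_cast hn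
  rw [Real.norm_of_nonneg (by positivity)]
  -- The degree-eight term of the exponential series gives decay `n⁻⁴`, which leaves `n⁻³` after the
  -- linear factor.
  have h1 := Real.pow_div_factorial_le_exp (√n) (Real.sqrt_nonneg _) 8
  have h2 : √(n : ℝ) ^ 8 = (n : ℝ) ^ 4 := by
    rw [show 8 = 2 * 4 from rfl, pow_mul, Real.sq_sqrt (by positivity)]
  rw [h2] at h1
  have h3 : Real.exp (-√n) ≤ Nat.factorial 8 / (n : ℝ) ^ 4 := by
    rw [Real.exp_neg, ← inv_div]
    exact inv_anti₀ (by positivity) h1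
  calc Real.exp (-√n) * (1 + n * Real.exp 1)
      ≤ Nat.factorial 8 / (n : ℝ) ^ 4 * (n * (1 + Real.exp 1)) := by
        gcongr
        linarith
    _ = _ := by
        field_simp

/-- Almost surely, the radius at time `n` is at most of order `√n`. -/
theorem IsBallisticAggregation.exists_ae_eventually_rad_lt (hF : IsBallisticAggregation P F)
    (hd : 2 ≤ d) : ∃ K : ℝ, 0 < K ∧ ∀ᵐ ω ∂P, ∀ᶠ n : ℕ in atTop, rad (F n ω) < K * √n := by
  obtain ⟨C, hC, hCb⟩ := exists_ballisticMeasure_le hd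
  set a := C * 3 ^ d * Real.exp 1 with ha
  have ha0 : 0 < a := by positivity
  -- With `R = (2 + a) √n` the exponent `n a / R - R` is at most `√n - 2 √n = -√n`.
  refine ⟨2 * (2 + a), by positivity, ?_⟩
  have hb : ∀ n : ℕ, P {ω | 2 * ((2 + a) * √n) ≤ rad (F n ω)} ≤
      ENNReal.ofReal (Real.exp (-√n) * (1 + n * Real.exp 1)) := by
    intro n
    rcases Nat.eq_zero_or_pos n with rfl | hn
    -- `F 0` is arbitrary, but at `n = 0` the claimed bound equals `1`.
    · simpa using prob_le_one
    have hn' : (0 : ℝ) < √n := Real.sqrt_pos.2 (by exact_mod_cast hn)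
    have hR : 0 < (2 + a) * √n := by positivity
    refine (hF.measure_le_rad_le hC.le hR (fun A hA hRA => hCb A hA _ hR hRA) hn).trans ?_
    refine ENNReal.ofReal_le_ofReal ?_
    gcongr
    rw [← ha]
    have h1 : (n : ℝ) * (a / ((2 + a) * √n)) = a / (2 + a) * √n := by
      nth_rewrite 1 [← Real.mul_self_sqrt (Nat.cast_nonneg n)]
      field_simp
    have h2 : a / (2 + a) ≤ 1 := (div_le_one (by positivity)).2 (by linarith)
    rw [h1]
    nlinarith
  have hsum : ∑' n : ℕ, P {ω | 2 * ((2 + a) * √n) ≤ rad (F n ω)} ≠ ∞ :=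
    ne_top_of_le_ne_top summable_exp_neg_sqrt_mul.tsum_ofReal_ne_top
      (ENNReal.tsum_le_tsum hb)
  filter_upwards [ae_eventually_notMem hsum] with ω hω
  filter_upwards [hω] with n hn
  rw [mul_assoc]
  exact not_le.1 hn

end Growth

/-! ### From the radius bound to the fractal dimension. -/

theorem card_le_of_rad_le_one {A : Finset (Lattice d)} (h : rad A ≤ 1) : A.card ≤ 3 ^ d := by
  rw [← card_Icc_neighborhood (0 : Lattice d)]
  refine Finset.card_le_card fun x hx => ?_
  have h1 : ‖toSpace x‖ ≤ 1 := ((le_rad_iff ⟨x, hx⟩).2 ⟨x, hx, le_rfl⟩).trans h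
  have h2 : ∀ i, |x i| ≤ 1 := fun i => by
    have : |(x i : ℝ)| ≤ 1 := (PiLp.norm_apply_le (toSpace x) i).trans h1
    exact_mod_cast this
  rw [Finset.mem_Icc]
  exact ⟨fun i => by simpa using (abs_le.1 (h2 i)).1, fun i => by simpa using (abs_le.1 (h2 i)).2⟩

/-- Sets of `n` points with radius at most of order `√n` have lower fractal dimension
at least two. -/
theorem two_le_lowerFractalDim {A : ℕ → Finset (Lattice d)} {K : ℝ} (hK : 0 < K)
    (hcard : ∀ᶠ n in atTop, (A n).card = n) (hrad : ∀ᶠ n : ℕ in atTop, rad (A n) < K * √n) :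
    2 ≤ lowerFractalDim A := by
  have hlog : Tendsto (fun n : ℕ => Real.log n) atTop atTop :=
    Real.tendsto_log_atTop.comp tendsto_natCast_atTop_atTop
  -- The comparison sequence is `log n / (log K + (log n) / 2)`, divided through by `log n`.
  have hlim : Tendsto (fun n : ℕ => (Real.log K / Real.log n + 1 / 2)⁻¹) atTop (𝓝 2) := by
    have h := ((tendsto_const_nhds (x := Real.log K)).div_atTop hlog).add_const (1 / 2)
    have h' := h.inv₀ (by norm_num)
    norm_num at h'
    simpa using h'
  have hlim' : Tendsto (fun n : ℕ => (((Real.log K / Real.log n + 1 / 2)⁻¹ : ℝ) : EReal)) atTop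
      (𝓝 ((2 : ℝ) : EReal)) := (continuous_coe_real_ereal.tendsto _).comp hlim
  have h2 : (2 : EReal) = ((2 : ℝ) : EReal) := rfl
  rw [lowerFractalDim, h2, ← hlim'.liminf_eq]
  refine liminf_le_liminf ?_
  filter_upwards [hcard, hrad, eventually_gt_atTop (3 ^ d), hlog.eventually_gt_atTop 0]
    with n hn hr hnd hl
  rw [EReal.coe_le_coe_iff, hn]
  -- Comparing the quotients needs `log (rad (A n)) > 0`; this holds once there are more than `3 ^
  -- d` points.
  have hr1 : 1 < rad (A n) := by
    by_contra! h
    have := card_le_of_rad_le_one h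
    omega
  have hn0 : (0 : ℝ) < n := by exact_mod_cast (Nat.zero_le _).trans_lt hnd
  have h3 : Real.log (rad (A n)) ≤ Real.log K + Real.log n / 2 := by
    refine (Real.log_le_log (by linarith) hr.le).trans_eq ?_
    rw [Real.log_mul hK.ne' (Real.sqrt_pos.2 hn0).ne', Real.log_sqrt hn0.le]
  have h4 : Real.log K / Real.log n + 1 / 2 = (Real.log K + Real.log n / 2) / Real.log n := by
    field_simp
  rw [h4, inv_div]
  have h5 := Real.log_pos hr1
  gcongr

end BallisticAggregation

end

theorem mainTheorem5 {d : ℕ} (hd : 3 ≤ d) {Ω : Type*} [MeasurableSpace Ω] (P : Measure Ω)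
    [IsProbabilityMeasure P] (F : ℕ → Ω → Finset (BallisticAggregation.Lattice d))
    (hF : BallisticAggregation.IsBallisticAggregation P F) :
    ∀ᵐ ω ∂P, 2 ≤ BallisticAggregation.lowerFractalDim (fun n => F n ω) := by
  obtain ⟨K, hK, hKF⟩ := hF.exists_ae_eventually_rad_lt (by omega)
  have hcard : ∀ᵐ ω ∂P, ∀ n, 1 ≤ n → (F n ω).card = n := by
    refine ae_all_iff.2 fun n => ?_
    by_cases hn : 1 ≤ n
    · filter_upwards [hF.ae_isRooted_and_card hn] with ω hω _
      exact hω.2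
    · exact Eventually.of_forall fun ω h => absurd h hn
  filter_upwards [hKF, hcard] with ω h1 h2
  exact BallisticAggregation.two_le_lowerFractalDim hK
    (by filter_upwards [eventually_ge_atTop 1] with n hn using h2 n hn) h1
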